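/- Let $(M,d)$ be a metric space, let $K\ge 0$, and let $\mathbb{P},\mathbb{Q}$ be Borel probability measures on $M$. For a Borel probability measure $\mu$ on a metric space $(N,d_N)$ and $p\ge 1$ write $\sigma_{\mu,p}(x)=\left(\int_N d_N(x,y)^p\,d\mu(y)\right)^{1/p}$. For $x_0\in\mathbb{R}^n$ (with the Euclidean distance) put $$L_{p,n,K}(\mathbb{P},\mathbb{Q})=\sup_{f}\ \bigl(\sigma_{f_*\mathbb{P},p}(x_0)-\sigma_{f_*\mathbb{Q},p}(x_0)\bigr),$$ where $f$ runs over all $K$-Lipschitz maps $f:M\to\mathbb{R}^n$ and $f_*$ denotes push-forward. Let $$W_p(\mathbb{P},\mathbb{Q})=\inf_{\gamma}\left(\int_{M\times M}d(x,y)^p\,d\gamma(x,y)\right)^{1/p},$$ where $\gamma$ runs over all probability measures on $M\times M$ with marginals $\mathbb{P}$ and $\mathbb{Q}$. Suppose that the supports of $\mathbb{P}$ and $\mathbb{Q}$ are compact and that $\mathbb{P}(\operatorname{supp}\mathbb{P})=\mathbb{Q}(\operatorname{supp}\mathbb{Q})=1$ (this last condition is automatic if $M$ is separable). Then $W_1(\mathbb{P},\mathbb{Q})<\infty$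 and, for every base point $x_0\in\mathbb{R}$, $$L_{1,1,K}(\mathbb{P},\mathbb{Q})=K\cdot W_1(\mathbb{P},\mathbb{Q}).$$ -/

import Mathlib

open MeasureTheory
open scoped ENNReal NNReal

noncomputable section

/-- The `p`-centrality function `σ_{μ,p}(x) = (∫ d(x,y)^p dμ(y))^(1/p)` of a Borel measure `μ`,
as an extended nonnegative real (it is `∞` when the `p`-th moment is infinite). -/
def pCentrality {N : Type*} [MetricSpace N] [MeasurableSpace N]
    (μ : Measure N) (p : ℝ) (x : N) : ℝ≥0∞ :=
  (∫⁻ y, edist x y ^ p ∂μ) ^ (1 / p)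

/-- The couplings of `μ` and `ν`: measures on the product with marginals `μ` and `ν`. -/
def couplings {M : Type*} [MeasurableSpace M] (μ ν : Measure M) : Set (Measure (M × M)) :=
  {γ | γ.map Prod.fst = μ ∧ γ.map Prod.snd = ν}

/-- The `p`-Wasserstein distance
`W_p(μ,ν) = inf_γ (∫ d(x,y)^p dγ(x,y))^(1/p)`, the infimum being over all couplings `γ`. -/
def wassersteinDist {M : Type*} [MetricSpace M] [MeasurableSpace M]
    (p : ℝ) (μ ν : Measure M) : ℝ≥0∞ :=
  ⨅ γ ∈ couplings μ ν, (∫⁻ z, edist z.1 z.2 ^ p ∂γ) ^ (1 / p)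

/-- The maximal `p`-centrality discrepancy with `n`-dimensional critic output, Lipschitz constant
`K` and base point `x₀`:
`L_{p,n,K}(μ,ν) = sup { σ_{f_*μ,p}(x₀) - σ_{f_*ν,p}(x₀) | f : M → ℝⁿ is K-Lipschitz }`.
The difference and the supremum are taken in the extended reals `[-∞, ∞]`; in Mathlib `∞ - ∞` is
`-∞` there, so that an `f` for which both terms are infinite does not contribute. -/
def maxCentralityDiscrepancy {M : Type*} [MetricSpace M] [MeasurableSpace M]
    (p : ℝ) (n : ℕ) (K : ℝ≥0) (x₀ : EuclideanSpace ℝ (Fin n)) (μ ν : Measure M) : EReal :=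
  ⨆ f ∈ {f : M → EuclideanSpace ℝ (Fin n) | LipschitzWith K f},
    ((pCentrality (μ.map f) p x₀ : ℝ≥0∞) : EReal) - ((pCentrality (ν.map f) p x₀ : ℝ≥0∞) : EReal)

end

/-!
The statement is Kantorovich–Rubinstein duality in disguise: for a `K`-Lipschitz `f : M → ℝ` the
function `d(x₀, f ·)` is a `K`-Lipschitz function with values in `[0, ∞)`, and on the compact set
`S = supp P ∪ supp Q`, which carries both measures, every `K`-Lipschitz function is of this form up
to an additive constant, which does not change the difference of its two integrals.

The inequality `L ≤ K W₁` (`pCentrality_one_map_le`) holds coupling by coupling, by the triangle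
inequality. The converse needs, for a bound `D` of `∫ φ dP - ∫ φ dQ` over all `1`-Lipschitz `φ`, a
coupling of cost at most `D` (`exists_coupling_integral_dist_le`). It is constructed on a compact
metric space `X` as follows. On the functions `a ⊕ b : (x, y) ↦ a x + b y` the functional
`a ⊕ b ↦ ∫ a dP + ∫ b dQ` is nonnegative whenever `a ⊕ b ≥ t (D - d)` for some `t ≥ 0`
(`integral_add_integral_nonneg`), because a `1`-Lipschitz function fits between `-b / t` and
`a / t - D`. By M. Riesz's extension theorem it extends to a functional on `C(X × X, ℝ)` that is
nonnegative on the cone of all functions dominating some `t (D - d)`. The case `t = 0` makes it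
positive, hence a measure by the Riesz–Markov–Kakutani theorem; its values on `a ⊕ b` give the
marginals, and its nonnegativity at `D - d` bounds the cost. The passage from `S` to `M` uses
McShane's extension of Lipschitz functions; it also avoids the nonmeasurability of the distance for
the product `σ`-algebra of a nonseparable space.
-/

/-! ### Kantorovich–Rubinstein duality on a compact metric space -/

/-- The `d`-transform of `a`, the infimum of the functions `a x + d(x, ·)`, separates `a` from `-b`
and is `1`-Lipschitz. -/
theorem exists_lipschitz_between {X : Type*} [MetricSpace X] [Nonempty X]
    (a b : X → ℝ) (hab : ∀ x y, 0 ≤ a x + b y + dist x y) :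
    ∃ φ : X → ℝ, LipschitzWith 1 φ ∧ (∀ x, φ x ≤ a x) ∧ ∀ y, -b y ≤ φ y := by
  have hbdd (y : X) : BddBelow (Set.range fun x ↦ a x + dist x y) :=
    ⟨-b y, by rintro _ ⟨x, rfl⟩; dsimp only; linarith [hab x y]⟩
  refine ⟨fun y ↦ ⨅ x, (a x + dist x y), LipschitzWith.of_le_add fun y z ↦ ?_, fun x ↦ ?_,
    fun y ↦ le_ciInf fun x ↦ by linarith [hab x y]⟩
  · rw [← sub_le_iff_le_add]
    refine le_ciInf fun x ↦ ?_
    have h := ciInf_le (hbdd y) x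
    have := dist_triangle_right x y z
    linarith
  · simpa using ciInf_le (hbdd x) x

theorem ContinuousMap.integrable_of_compactSpace {X : Type*} [TopologicalSpace X] [CompactSpace X]
    [MeasurableSpace X] [BorelSpace X] (μ : Measure X) [IsFiniteMeasure μ] (f : C(X, ℝ)) :
    Integrable f μ :=
  f.continuous.integrable_of_hasCompactSupport (HasCompactSupport.of_compactSpace _)

/-- Weak duality: if `D` bounds `∫ φ dP - ∫ φ dQ` over all `1`-Lipschitz `φ`, then the functional
`a ⊕ b ↦ ∫ a dP + ∫ b dQ` is nonnegative on the functions dominating some `t (D - d)`, `t ≥ 0`. -/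
theorem integral_add_integral_nonneg {X : Type*} [MetricSpace X] [CompactSpace X]
    [MeasurableSpace X] [BorelSpace X] (P Q : Measure X) [IsProbabilityMeasure P]
    [IsProbabilityMeasure Q] {D : ℝ}
    (hD : ∀ φ : X → ℝ, LipschitzWith 1 φ → ∫ x, φ x ∂P - ∫ x, φ x ∂Q ≤ D)
    (a b : C(X, ℝ)) {t : ℝ} (ht : 0 ≤ t) (h : ∀ x y, t * (D - dist x y) ≤ a x + b y) :
    0 ≤ ∫ x, a x ∂P + ∫ x, b x ∂Q := by
  have : Nonempty X := nonempty_of_isProbabilityMeasure P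
  have hP (f : C(X, ℝ)) := f.integrable_of_compactSpace P
  have hQ (f : C(X, ℝ)) := f.integrable_of_compactSpace Q
  rcases ht.eq_or_lt with rfl | ht
  · -- Here `-b ≤ c ≤ a` for the constant `c = min a`.
    obtain ⟨x₀, -, hx₀⟩ := isCompact_univ.exists_isMinOn Set.univ_nonempty a.continuous.continuousOn
    have h1 : ∫ _, a x₀ ∂P ≤ ∫ x, a x ∂P :=
      integral_mono (integrable_const _) (hP a) fun x ↦ hx₀ (Set.mem_univ x)
    have h2 : ∫ _, -a x₀ ∂Q ≤ ∫ x, b x ∂Q :=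
      integral_mono (integrable_const _) (hQ b) fun x ↦ by
        have := h x₀ x
        dsimp only
        linarith
    simp only [integral_const, probReal_univ, one_smul] at h1 h2
    linarith
  · -- Dividing by `t` yields a `1`-Lipschitz `φ` with `-b / t ≤ φ ≤ a / t - D`.
    obtain ⟨φ, hφ, hφa, hφb⟩ := exists_lipschitz_between
      (t⁻¹ • a - ContinuousMap.const X D : C(X, ℝ)) (fun y ↦ t⁻¹ * b y) fun x y ↦ by
        have := mul_le_mul_of_nonneg_left (h x y) (inv_nonneg.2 ht.le)
        rw [inv_mul_cancel_left₀ ht.ne'] at this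
        simp only [ContinuousMap.sub_apply, ContinuousMap.smul_apply, smul_eq_mul,
          ContinuousMap.const_apply]
        linarith
    have h1 := integral_mono (hP ⟨φ, hφ.continuous⟩)
      (hP (t⁻¹ • a - ContinuousMap.const X D)) hφa
    have h2 := integral_mono ((hQ b).const_mul t⁻¹).neg (hQ ⟨φ, hφ.continuous⟩) hφb
    have h3 := hD _ hφ.neg
    simp only [ContinuousMap.coe_mk, ContinuousMap.sub_apply, ContinuousMap.smul_apply,
      smul_eq_mul, ContinuousMap.const_apply, Pi.neg_apply, integral_neg, integral_const_mul]
      at h1 h2 h3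
    rw [integral_sub ((hP a).const_mul _) (integrable_const _), integral_const_mul] at h1
    simp only [integral_const, probReal_univ, one_smul] at h1
    have : 0 ≤ t⁻¹ * (∫ x, a x ∂P + ∫ x, b x ∂Q) := by linarith
    exact nonneg_of_mul_nonneg_right this (inv_pos.2 ht)

/-- The linear map `(a, b) ↦ a ⊕ b`, where `(a ⊕ b)(x, y) = a x + b y`. -/
def directSumMap (X : Type*) [TopologicalSpace X] :
    C(X, ℝ) × C(X, ℝ) →ₗ[ℝ] C(X × X, ℝ) where
  toFun p := p.1.comp .fst + p.2.comp .snd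
  map_add' p q := by ext z; simp; ring
  map_smul' c p := by ext z; simp

theorem directSumMap_apply {X : Type*} [TopologicalSpace X] (p : C(X, ℝ) × C(X, ℝ)) (z : X × X) :
    directSumMap X p z = p.1 z.1 + p.2 z.2 := rfl

/-- Integration of continuous functions on a compact space, as a linear functional. -/
noncomputable def integralLinearMap {X : Type*} [TopologicalSpace X] [CompactSpace X]
    [MeasurableSpace X] [BorelSpace X] (μ : Measure X) [IsFiniteMeasure μ] : C(X, ℝ) →ₗ[ℝ] ℝ where
  toFun f := ∫ x, f x ∂μ
  map_add' f g :=
    integral_add (f.integrable_of_compactSpace μ) (g.integrable_of_compactSpace μ)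
  map_smul' c _ := integral_const_mul c _

/-- The cone of the functions on `X × X` that dominate `t (D - d)` for some `t ≥ 0`. -/
def costCone (X : Type*) [MetricSpace X] (D : ℝ) : PointedCone ℝ C(X × X, ℝ) where
  carrier := {u | ∃ t : ℝ, 0 ≤ t ∧ ∀ z, t * (D - dist z.1 z.2) ≤ u z}
  zero_mem' := ⟨0, le_rfl, by simp⟩
  add_mem' := by
    rintro u v ⟨s, hs, hu⟩ ⟨t, ht, hv⟩
    refine ⟨s + t, add_nonneg hs ht, fun z ↦ ?_⟩
    rw [add_mul]
    exact add_le_add (hu z) (hv z)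
  smul_mem' := by
    rintro c u ⟨t, ht, hu⟩
    refine ⟨c * t, mul_nonneg c.2 ht, fun z ↦ ?_⟩
    rw [mul_assoc]
    exact mul_le_mul_of_nonneg_left (hu z) c.2

/-- Extension step of the duality: the functional `a ⊕ b ↦ ∫ a dP + ∫ b dQ` extends to a functional
on `C(X × X, ℝ)` that is nonnegative on `costCone X D`. -/
theorem exists_linearMap_nonneg_on_costCone {X : Type*} [MetricSpace X] [CompactSpace X]
    [MeasurableSpace X] [BorelSpace X] (P Q : Measure X) [IsProbabilityMeasure P]
    [IsProbabilityMeasure Q] {D : ℝ}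
    (hD : ∀ φ : X → ℝ, LipschitzWith 1 φ → ∫ x, φ x ∂P - ∫ x, φ x ∂Q ≤ D) :
    ∃ Λ : C(X × X, ℝ) →ₗ[ℝ] ℝ,
      (∀ p, Λ (directSumMap X p) = ∫ x, p.1 x ∂P + ∫ x, p.2 x ∂Q) ∧
        ∀ u ∈ costCone X D, 0 ≤ Λ u := by
  -- Integration against the product measure shows that the functional is well defined.
  have hprod (p : C(X, ℝ) × C(X, ℝ)) : integralLinearMap (P.prod Q) (directSumMap X p) =
      ∫ x, p.1 x ∂P + ∫ x, p.2 x ∂Q := by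
    change ∫ z, (p.1 z.1 + p.2 z.2) ∂(P.prod Q) = _
    rw [integral_add ((p.1.integrable_of_compactSpace P).comp_fst Q)
      ((p.2.integrable_of_compactSpace Q).comp_snd P), integral_fun_fst, integral_fun_snd]
    simp
  have hnonneg (u : LinearMap.range (directSumMap X)) (hu : (u : C(X × X, ℝ)) ∈ costCone X D) :
      0 ≤ integralLinearMap (P.prod Q) u := by
    obtain ⟨_, p, rfl⟩ := u
    obtain ⟨t, ht, h⟩ := hu
    exact (integral_add_integral_nonneg P Q hD p.1 p.2 ht fun x y ↦ h (x, y)).trans_eq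
      (hprod p).symm
  have hdense (u : C(X × X, ℝ)) :
      ∃ v : LinearMap.range (directSumMap X), (v : C(X × X, ℝ)) + u ∈ costCone X D := by
    refine ⟨⟨_, (ContinuousMap.const X ‖u‖, 0), rfl⟩, 0, le_rfl, fun z ↦ ?_⟩
    have := neg_le_of_abs_le (u.norm_coe_le_norm z)
    simp only [ContinuousMap.add_apply, directSumMap_apply, ContinuousMap.const_apply,
      ContinuousMap.zero_apply]
    linarith
  obtain ⟨Λ, hΛ, hΛ0⟩ := riesz_extension (costCone X D)
    ⟨LinearMap.range (directSumMap X), (integralLinearMap (P.prod Q)).domRestrict _⟩ hnonneg hdense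
  exact ⟨Λ, fun p ↦ (hΛ ⟨_, p, rfl⟩).trans (hprod p), hΛ0⟩

/-- The hard half of the duality: if `D` bounds `∫ φ dP - ∫ φ dQ` over the `1`-Lipschitz
functions `φ`, then some coupling has cost at most `D`. -/
theorem exists_coupling_integral_dist_le {X : Type*} [MetricSpace X] [CompactSpace X]
    [MeasurableSpace X] [BorelSpace X] (P Q : Measure X) [IsProbabilityMeasure P]
    [IsProbabilityMeasure Q] {D : ℝ}
    (hD : ∀ φ : X → ℝ, LipschitzWith 1 φ → ∫ x, φ x ∂P - ∫ x, φ x ∂Q ≤ D) :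
    ∃ γ ∈ couplings P Q, ∫⁻ z, edist z.1 z.2 ∂γ ≤ ENNReal.ofReal D := by
  obtain ⟨Λ, hΛ, hΛ0⟩ := exists_linearMap_nonneg_on_costCone P Q hD
  let Ψ : CompactlySupportedContinuousMap (X × X) ℝ →ₚ[ℝ] ℝ := PositiveLinearMap.mk₀
    { toFun := fun f ↦ Λ f.toContinuousMap
      map_add' := fun f g ↦ Λ.map_add f.toContinuousMap g.toContinuousMap
      map_smul' := fun c f ↦ Λ.map_smul c f.toContinuousMap }
    fun f hf ↦ hΛ0 _ ⟨0, le_rfl, fun z ↦ by simpa using hf z⟩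
  let γ := RealRMK.rieszMeasure Ψ
  have hγ (f : C(X × X, ℝ)) : ∫ z, f z ∂γ = Λ f :=
    RealRMK.integral_rieszMeasure Ψ (CompactlySupportedContinuousMap.continuousMapEquiv f)
  have : IsFiniteMeasure γ := ⟨isCompact_univ.measure_lt_top⟩
  have hfst : γ.map Prod.fst = P := by
    refine ext_of_forall_integral_eq_of_IsFiniteMeasure fun f ↦ ?_
    rw [integral_map measurable_fst.aemeasurable f.continuous.aestronglyMeasurable]
    have h := (hγ _).trans (hΛ (f.toContinuousMap, 0))
    simpa [directSumMap_apply] using h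
  have hsnd : γ.map Prod.snd = Q := by
    refine ext_of_forall_integral_eq_of_IsFiniteMeasure fun f ↦ ?_
    rw [integral_map measurable_snd.aemeasurable f.continuous.aestronglyMeasurable]
    have h := (hγ _).trans (hΛ (0, f.toContinuousMap))
    simpa [directSumMap_apply] using h
  refine ⟨γ, ⟨hfst, hsnd⟩, ?_⟩
  let d : C(X × X, ℝ) := ⟨fun z ↦ dist z.1 z.2, continuous_dist⟩
  have hd : Λ d ≤ D := by
    have h1 := hΛ0 (directSumMap X (ContinuousMap.const X D, 0) - d)
      ⟨1, zero_le_one, fun z ↦ by simp [directSumMap_apply, d]⟩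
    have h2 := hΛ (ContinuousMap.const X D, 0)
    simp only [ContinuousMap.const_apply, ContinuousMap.zero_apply, integral_const,
      probReal_univ, one_smul, smul_zero, add_zero] at h2
    rw [map_sub, h2] at h1
    linarith
  calc ∫⁻ z, edist z.1 z.2 ∂γ = ∫⁻ z, ENNReal.ofReal (d z) ∂γ := by simp only [edist_dist]; rfl
    _ = ENNReal.ofReal (∫ z, d z ∂γ) := (ofReal_integral_eq_lintegral_ofReal
        (d.integrable_of_compactSpace γ) (.of_forall fun _ ↦ dist_nonneg)).symm
    _ ≤ ENNReal.ofReal D := ENNReal.ofReal_le_ofReal ((hγ d).trans_le hd)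

/-! ### Measures carried by a compact set -/

/-- The compact case of the duality carries over to measures on an arbitrary metric space that are
concentrated on a compact set: couplings are pushed forward along the inclusion and test functions
are extended by McShane's theorem. -/
theorem wassersteinDist_one_le_of_forall_integral_sub_le {M : Type*} [MetricSpace M]
    [MeasurableSpace M] [BorelSpace M] (P Q : Measure M) [IsProbabilityMeasure P]
    [IsProbabilityMeasure Q] {S : Set M} (hS : IsCompact S) (hPS : P Sᶜ = 0) (hQS : Q Sᶜ = 0)
    {D : ℝ} (hD : ∀ φ : M → ℝ, LipschitzWith 1 φ → ∫ x, φ x ∂P - ∫ x, φ x ∂Q ≤ D) :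
    wassersteinDist 1 P Q ≤ ENNReal.ofReal D := by
  have : CompactSpace S := isCompact_iff_compactSpace.1 hS
  have hSm : MeasurableSet S := hS.measurableSet
  have hmap (μ : Measure M) (hμ : μ Sᶜ = 0) : (μ.comap ((↑) : S → M)).map (↑) = μ := by
    rw [map_comap_subtype_coe hSm, Measure.restrict_eq_self_of_ae_mem (by rwa [ae_iff])]
  have hprob (μ : Measure M) [IsProbabilityMeasure μ] (hμ : μ Sᶜ = 0) :
      IsProbabilityMeasure (μ.comap ((↑) : S → M)) := by
    rw [← Measure.isProbabilityMeasure_map_iff measurable_subtype_coe.aemeasurable, hmap μ hμ]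
    infer_instance
  have := hprob P hPS
  have := hprob Q hQS
  obtain ⟨γ, ⟨hγP, hγQ⟩, hγ⟩ := exists_coupling_integral_dist_le
      (P.comap ((↑) : S → M)) (Q.comap ((↑) : S → M)) (D := D) fun φ hφ ↦ by
    have hφ' : LipschitzOnWith 1 (Function.extend ((↑) : S → M) φ 0) S := by
      rw [lipschitzOnWith_iff_restrict]
      have : S.domRestrict (Function.extend ((↑) : S → M) φ 0) = φ :=
        funext (Subtype.val_injective.extend_apply φ 0)
      rwa [this]
    obtain ⟨ψ, hψ, hψφ⟩ := hφ'.extend_real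
    have hφψ (x : S) : φ x = ψ x := by
      rw [← hψφ x.2, Subtype.val_injective.extend_apply]
    have hint (μ : Measure M) (hμ : μ Sᶜ = 0) :
        ∫ x, φ x ∂(μ.comap ((↑) : S → M)) = ∫ x, ψ x ∂μ := by
      conv_rhs => rw [← hmap μ hμ]
      rw [(MeasurableEmbedding.subtype_coe hSm).integral_map]
      simp only [hφψ]
    rw [hint P hPS, hint Q hQS]
    exact hD ψ hψ
  have hι : Measurable (Prod.map ((↑) : S → M) ((↑) : S → M)) := by fun_prop
  have hmem : γ.map (Prod.map (↑) (↑)) ∈ couplings P Q := by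
    constructor
    · rw [Measure.map_map measurable_fst hι, ← hmap P hPS, ← hγP,
        Measure.map_map measurable_subtype_coe measurable_fst]
      rfl
    · rw [Measure.map_map measurable_snd hι, ← hmap Q hQS, ← hγQ,
        Measure.map_map measurable_subtype_coe measurable_snd]
      rfl
  refine (iInf₂_le _ hmem).trans ?_
  simp only [ENNReal.rpow_one, div_one]
  -- For nonseparable `M` the integrand need not be measurable, but only one inequality is needed.
  exact (lintegral_map_le _ _).trans hγ

/-- The product coupling has finite cost, since it is carried by a set of finite diameter. -/
theorem wassersteinDist_one_ne_top {M : Type*} [MetricSpace M]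
    [MeasurableSpace M] [BorelSpace M] (P Q : Measure M) [IsProbabilityMeasure P]
    [IsProbabilityMeasure Q] {S : Set M} (hS : IsCompact S) (hPS : P Sᶜ = 0) (hQS : Q Sᶜ = 0) :
    wassersteinDist 1 P Q ≠ ∞ := by
  have hmem : P.prod Q ∈ couplings P Q := ⟨by simp, by simp⟩
  refine ((iInf₂_le _ hmem).trans_lt ?_).ne
  simp only [ENNReal.rpow_one, div_one]
  have h1 : ∀ᵐ z ∂(P.prod Q), z.1 ∈ S := Measure.quasiMeasurePreserving_fst.ae (by rwa [ae_iff])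
  have h2 : ∀ᵐ z ∂(P.prod Q), z.2 ∈ S := Measure.quasiMeasurePreserving_snd.ae (by rwa [ae_iff])
  calc ∫⁻ z, edist z.1 z.2 ∂(P.prod Q) ≤ ∫⁻ _, Metric.ediam S ∂(P.prod Q) := by
        refine lintegral_mono_ae ?_
        filter_upwards [h1, h2] with z hz1 hz2 using Metric.edist_le_ediam_of_mem hz1 hz2
    _ = Metric.ediam S := by simp
    _ < ∞ := hS.isBounded.ediam_ne_top.lt_top

/-! ### Centrality functions of push-forwards -/

theorem pCentrality_one_map {M N : Type*} [MetricSpace M] [MeasurableSpace M] [BorelSpace M]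
    [MetricSpace N] [MeasurableSpace N] [BorelSpace N] (μ : Measure M) {f : M → N}
    (hf : Continuous f) (x₀ : N) :
    pCentrality (μ.map f) 1 x₀ = ∫⁻ x, edist x₀ (f x) ∂μ := by
  simp only [pCentrality, ENNReal.rpow_one, div_one]
  exact lintegral_map (continuous_const.edist continuous_id).measurable hf.measurable

/-- The easy half of the duality, for the `K`-Lipschitz function `d(x₀, f ·)`. -/
theorem pCentrality_one_map_le {M N : Type*} [MetricSpace M] [MeasurableSpace M] [BorelSpace M]
    [MetricSpace N] [MeasurableSpace N] [BorelSpace N] (P Q : Measure M) [IsProbabilityMeasure P]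
    [IsProbabilityMeasure Q] {K : ℝ≥0} {f : M → N}
    (hf : LipschitzWith K f) (x₀ : N) :
    pCentrality (P.map f) 1 x₀ ≤
      K * wassersteinDist 1 P Q + pCentrality (Q.map f) 1 x₀ := by
  rw [pCentrality_one_map P hf.continuous, pCentrality_one_map Q hf.continuous]
  have hmeas : Measurable fun x ↦ edist x₀ (f x) :=
    (continuous_const.edist hf.continuous).measurable
  have hmeas' : Measurable fun z : M × M ↦ edist x₀ (f z.2) := hmeas.comp measurable_snd
  have key (γ) (hγ : γ ∈ couplings P Q) : ∫⁻ x, edist x₀ (f x) ∂P ≤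
      K * ∫⁻ z, edist z.1 z.2 ∂γ + ∫⁻ x, edist x₀ (f x) ∂Q := by
    obtain ⟨rfl, rfl⟩ := hγ
    rw [lintegral_map hmeas measurable_fst, lintegral_map hmeas measurable_snd,
      ← lintegral_const_mul' _ _ ENNReal.coe_ne_top,
      ← lintegral_add_right _ hmeas']
    refine lintegral_mono fun z ↦ ?_
    calc edist x₀ (f z.1) ≤ edist x₀ (f z.2) + edist (f z.2) (f z.1) := edist_triangle _ _ _
      _ ≤ K * edist z.1 z.2 + edist x₀ (f z.2) := by
        rw [add_comm, edist_comm (f z.2)]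
        gcongr
        exact hf z.1 z.2
  have : Nonempty (couplings P Q) := ⟨P.prod Q, by simp, by simp⟩
  rw [← tsub_le_iff_right, wassersteinDist, iInf_subtype', ENNReal.mul_iInf (by simp)]
  refine le_iInf fun γ ↦ ?_
  simpa [tsub_le_iff_right] using key γ γ.2

/-- A `1`-Lipschitz `φ`, shifted to be nonnegative on a compact set carrying `P` and `Q` and scaled
by `K`, is the distance to `x₀` of a `K`-Lipschitz map into the line. -/
theorem coe_mul_integral_sub_le_maxCentralityDiscrepancy {M : Type*} [MetricSpace M]
    [MeasurableSpace M] [BorelSpace M] (P Q : Measure M) [IsProbabilityMeasure P]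
    [IsProbabilityMeasure Q] {S : Set M} (hS : IsCompact S) (hPS : P Sᶜ = 0) (hQS : Q Sᶜ = 0)
    (K : ℝ≥0) (x₀ : EuclideanSpace ℝ (Fin 1)) {φ : M → ℝ} (hφ : LipschitzWith 1 φ) :
    ((K * (∫ x, φ x ∂P - ∫ x, φ x ∂Q) : ℝ) : EReal) ≤ maxCentralityDiscrepancy 1 1 K x₀ P Q := by
  obtain ⟨c, hc⟩ := hS.exists_bound_of_continuousOn hφ.continuous.continuousOn
  let f : M → EuclideanSpace ℝ (Fin 1) := fun x ↦ x₀ + EuclideanSpace.single 0 (K * (φ x + c))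
  have hf : LipschitzWith K f := LipschitzWith.of_dist_le_mul fun x y ↦ by
    have := hφ.dist_le_mul x y
    simp only [NNReal.coe_one, one_mul, Real.dist_eq] at this
    simp only [f, dist_add_left, PiLp.dist_single_same, Real.dist_eq]
    rw [← mul_sub, abs_mul, NNReal.abs_eq, add_sub_add_right_eq_sub]
    gcongr
  have hcent (μ : Measure M) [IsProbabilityMeasure μ] (hμ : μ Sᶜ = 0) :
      ((pCentrality (μ.map f) 1 x₀ : ℝ≥0∞) : EReal) = ((K * (∫ x, φ x ∂μ + c) : ℝ) : EReal) := by
    have hμS : ∀ᵐ x ∂μ, x ∈ S := by rwa [ae_iff]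
    have hint : Integrable φ μ :=
      .of_bound hφ.continuous.aestronglyMeasurable c (hμS.mono hc)
    have hnonneg : ∀ᵐ x ∂μ, 0 ≤ K * (φ x + c) := hμS.mono fun x hx ↦
      mul_nonneg K.2 (by linarith [neg_le_of_abs_le (hc x hx)])
    have heq : ∫ x, K * (φ x + c) ∂μ = K * (∫ x, φ x ∂μ + c) := by
      rw [integral_const_mul, integral_add hint (integrable_const c)]
      simp
    rw [pCentrality_one_map μ hf.continuous, ← heq]
    have : ∫⁻ x, edist x₀ (f x) ∂μ = ∫⁻ x, ENNReal.ofReal (K * (φ x + c)) ∂μ := by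
      refine lintegral_congr_ae (hnonneg.mono fun x hx ↦ ?_)
      simp only [f, edist_dist, dist_self_add_right, PiLp.norm_single, Real.norm_eq_abs,
        abs_of_nonneg hx]
    have hint' : Integrable (fun x ↦ K * (φ x + c)) μ :=
      (hint.add (integrable_const c)).const_mul _
    rw [this, ← ofReal_integral_eq_lintegral_ofReal hint' hnonneg, EReal.coe_ennreal_ofReal,
      max_eq_left (integral_nonneg_of_ae hnonneg)]
  refine le_trans (le_of_eq ?_) (le_iSup₂_of_le f hf le_rfl)
  rw [hcent P hPS, hcent Q hQS, ← EReal.coe_sub]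
  congr 1
  ring

/-! ### The discrepancy and the Wasserstein distance -/

theorem proposition3p7 {M : Type*} [MetricSpace M] [MeasurableSpace M] [BorelSpace M]
    (P Q : Measure M) [IsProbabilityMeasure P] [IsProbabilityMeasure Q]
    (hP : IsCompact P.support) (hQ : IsCompact Q.support)
    -- the support carries all the mass; this is automatic when `M` is separable
    (hP_full : P P.supportᶜ = 0) (hQ_full : Q Q.supportᶜ = 0)
    (K : ℝ≥0) (x₀ : EuclideanSpace ℝ (Fin 1)) :
    wassersteinDist 1 P Q ≠ ∞ ∧
      maxCentralityDiscrepancy 1 1 K x₀ P Q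
        = (((K : ℝ≥0∞) * wassersteinDist 1 P Q : ℝ≥0∞) : EReal) := by
  have hS := hP.union hQ
  have hPS : P (P.support ∪ Q.support)ᶜ = 0 :=
    measure_mono_null (Set.compl_subset_compl.2 Set.subset_union_left) hP_full
  have hQS : Q (P.support ∪ Q.support)ᶜ = 0 :=
    measure_mono_null (Set.compl_subset_compl.2 Set.subset_union_right) hQ_full
  have hW := wassersteinDist_one_ne_top P Q hS hPS hQS
  have hle : maxCentralityDiscrepancy 1 1 K x₀ P Q ≤
      (((K : ℝ≥0∞) * wassersteinDist 1 P Q : ℝ≥0∞) : EReal) :=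
    iSup₂_le fun f hf ↦ EReal.sub_le_of_le_add <| by
      exact_mod_cast pCentrality_one_map_le P Q hf x₀
  have hge {φ : M → ℝ} (hφ : LipschitzWith 1 φ) :=
    coe_mul_integral_sub_le_maxCentralityDiscrepancy P Q hS hPS hQS K x₀ hφ
  refine ⟨hW, hle.antisymm ?_⟩
  have h0 : 0 ≤ maxCentralityDiscrepancy 1 1 K x₀ P Q := by
    simpa using hge (LipschitzWith.const 0 |>.weaken zero_le_one)
  rcases eq_or_ne K 0 with rfl | hK
  · simpa using h0
  have hKpos : (0 : ℝ) < K := by positivity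
  obtain ⟨l, hl⟩ : ∃ l : ℝ, maxCentralityDiscrepancy 1 1 K x₀ P Q = l := by
    have htop : maxCentralityDiscrepancy 1 1 K x₀ P Q ≠ ⊤ :=
      ne_top_of_le_ne_top (EReal.coe_ennreal_eq_top_iff.not.2
        (ENNReal.mul_ne_top ENNReal.coe_ne_top hW)) hle
    exact ⟨_, (EReal.coe_toReal htop (EReal.bot_lt_zero.trans_le h0).ne').symm⟩
  rw [hl] at h0 hge ⊢
  have hl0 : 0 ≤ l := by exact_mod_cast h0
  have hWl : wassersteinDist 1 P Q ≤ ENNReal.ofReal (l / K) :=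
    wassersteinDist_one_le_of_forall_integral_sub_le P Q hS hPS hQS fun φ hφ ↦ by
      rw [le_div_iff₀' hKpos]
      exact_mod_cast hge hφ
  have : (K : ℝ≥0∞) * wassersteinDist 1 P Q ≤ ENNReal.ofReal l :=
    calc (K : ℝ≥0∞) * wassersteinDist 1 P Q ≤ ENNReal.ofReal K * ENNReal.ofReal (l / K) := by
          rw [ENNReal.ofReal_coe_nnreal]
          gcongr
      _ = ENNReal.ofReal l := by
          rw [← ENNReal.ofReal_mul hKpos.le, mul_div_cancel₀ _ hKpos.ne']
  refine (EReal.coe_ennreal_le_coe_ennreal_iff.2 this).trans_eq ?_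
  rw [EReal.coe_ennreal_ofReal, max_eq_left hl0]
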